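/- For integers $\ell\ge 2$ let $P_\ell$ be the Legendre polynomial and put $\lambda_s=(\ell+s)!/(\ell-s)!$, so that $\lambda_1=\ell(\ell+1)$ and $\lambda_2=(\ell+2)(\ell+1)\ell(\ell-1)$, and $\lambda=\lambda_2/\lambda_1=(\ell+2)(\ell-1)$. Let $${}_2Y_{\ell 0}(\theta)=\sqrt{\frac{2\ell+1}{4\pi\lambda_2}}\,(1-z^2)\,P_\ell''(z)\Big|_{z=\cos\theta},\qquad \theta\in[0,\pi],$$ be the axisymmetric spin-weighted spherical harmonic of spin weight $2$. Let $\theta,\theta_0\in[0,\pi]$, put $\theta_<=\min\{\theta,\theta_0\}$ and $\theta_>=\max\{\theta,\theta_0\}$, and assume that $\theta_>>0$ and $\theta_<<\pi$ (i.e. $\theta$ and $\theta_0$ are not both at the same pole). Then the following three series converge absolutely, and $$\sigma_1:=\sum_{\ell=2}^{\infty}\lambda_1^{-1}\,{}_2Y_{\ell0}(\theta)\,{}_2Y_{\ell0}(\theta_0)=\frac1{8\pi}\tan^2\!\Big(\frac{\theta_<}{2}\Big)\cot^2\!\Big(\frac{\theta_>}{2}\Big),$$ $$\sigma_2:=\sum_{\ell=2}^{\infty}\lambda^{-1}\,{}_2Y_{\ell0}(\theta)\,{}_2Y_{\ell0}(\theta_0)=\frac13\,\sigma_1\,(2+\cos\theta_<)(2-\cos\theta_>),$$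 $$\sigma_3:=\sum_{\ell=2}^{\infty}\lambda_2^{-1}\,{}_2Y_{\ell0}(\theta)\,{}_2Y_{\ell0}(\theta_0)=\frac12(\sigma_2-\sigma_1).$$ Moreover, for every $0<\theta_1<\pi/2$, the partial sums of each of the three series converge uniformly on $\{(\theta,\theta_0):\theta\in[0,\pi],\ \theta_0\in[\theta_1,\pi-\theta_1]\}$. -/

import Mathlib

open Polynomial Filter

/-- The Legendre polynomial `P_ℓ`, by Rodrigues' formula. -/
noncomputable def legendreP (ℓ : ℕ) : ℝ[X] :=
  C (1 / (2 ^ ℓ * (ℓ.factorial : ℝ))) * derivative^[ℓ] ((X ^ 2 - 1) ^ ℓ)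

/-- `λ_s = (ℓ + s)! / (ℓ - s)!`, used for `s = 1, 2` and `ℓ ≥ 2` only (so `s ≤ ℓ`). -/
noncomputable def lambdaS (s ℓ : ℕ) : ℝ :=
  ((ℓ + s).factorial : ℝ) / ((ℓ - s).factorial : ℝ)

/-- `λ = λ_2 / λ_1`, which is `(ℓ + 2) (ℓ - 1)` for `ℓ ≥ 2`. -/
noncomputable def lambdaRatio (ℓ : ℕ) : ℝ :=
  lambdaS 2 ℓ / lambdaS 1 ℓ

/-- The ordinary axisymmetric spherical harmonic `Y_{ℓ0}(θ)`. -/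
noncomputable def sphericalY (ℓ : ℕ) (θ : ℝ) : ℝ :=
  Real.sqrt ((2 * (ℓ : ℝ) + 1) / (4 * Real.pi)) * (legendreP ℓ).eval (Real.cos θ)

/-- The spin-raising operator `ð_s = -∂_θ + s cot θ` on axisymmetric functions
(meaningful away from the poles). -/
noncomputable def ethRaise (s : ℝ) (f : ℝ → ℝ) (θ : ℝ) : ℝ :=
  -deriv f θ + s * Real.cot θ * f θ

/-- The spin-weighted spherical harmonic `₂Y_{ℓ0}(θ)` (`ℓ ≥ 2`), in the form
`√((2ℓ+1) / (4π λ_2)) (1 - z²) P_ℓ''(z)` with `z = cos θ`, which is regular at the poles.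
`spinTwoY_eq_ethRaise` shows that it arises from `Y_{ℓ0}` by raising the spin twice. -/
noncomputable def spinTwoY (ℓ : ℕ) (θ : ℝ) : ℝ :=
  Real.sqrt ((2 * (ℓ : ℝ) + 1) / (4 * Real.pi * lambdaS 2 ℓ)) *
    ((1 - Real.cos θ ^ 2) * (derivative (derivative (legendreP ℓ))).eval (Real.cos θ))

/-- Away from the poles, `₂Y_{ℓ0} = λ_2^{-1/2} ð_1 ð_0 Y_{ℓ0}`. -/
theorem spinTwoY_eq_ethRaise (ℓ : ℕ) (θ : ℝ) (hθ : Real.sin θ ≠ 0) :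
    spinTwoY ℓ θ
      = (Real.sqrt (lambdaS 2 ℓ))⁻¹ * ethRaise 1 (ethRaise 0 (sphericalY ℓ)) θ := by
  set c := Real.sqrt ((2 * (ℓ : ℝ) + 1) / (4 * Real.pi)) with hc
  have hP : ∀ (p : ℝ[X]) (t : ℝ), HasDerivAt (fun x => p.eval (Real.cos x))
      ((derivative p).eval (Real.cos t) * (-Real.sin t)) t := fun p t =>
    (p.hasDerivAt (Real.cos t)).comp t (Real.hasDerivAt_cos t)
  have h0 : ethRaise 0 (sphericalY ℓ) =
      fun t => c * (Real.sin t * (derivative (legendreP ℓ)).eval (Real.cos t)) := by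
    funext t
    have h : HasDerivAt (sphericalY ℓ) _ t := (hP (legendreP ℓ) t).const_mul c
    simp only [ethRaise, h.deriv]
    ring
  have h1 : HasDerivAt
      (fun t => c * (Real.sin t * (derivative (legendreP ℓ)).eval (Real.cos t))) _ θ :=
    ((Real.hasDerivAt_sin θ).mul (hP (derivative (legendreP ℓ)) θ)).const_mul c
  have hs : Real.sqrt ((2 * (ℓ : ℝ) + 1) / (4 * Real.pi * lambdaS 2 ℓ))
      = (Real.sqrt (lambdaS 2 ℓ))⁻¹ * c := by
    rw [hc, ← div_div, Real.sqrt_div (by positivity), div_eq_inv_mul]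
  rw [h0, ethRaise, h1.deriv, spinTwoY, hs, Real.cot_eq_cos_div_sin, ← Real.sin_sq]
  field_simp
  ring

/-- The `ℓ`-th terms of the three series. -/
noncomputable def sigma1Term (ℓ : ℕ) (θ θ₀ : ℝ) : ℝ :=
  (lambdaS 1 ℓ)⁻¹ * spinTwoY ℓ θ * spinTwoY ℓ θ₀

noncomputable def sigma2Term (ℓ : ℕ) (θ θ₀ : ℝ) : ℝ :=
  (lambdaRatio ℓ)⁻¹ * spinTwoY ℓ θ * spinTwoY ℓ θ₀

noncomputable def sigma3Term (ℓ : ℕ) (θ θ₀ : ℝ) : ℝ :=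
  (lambdaS 2 ℓ)⁻¹ * spinTwoY ℓ θ * spinTwoY ℓ θ₀

/-- The sums over `ℓ ≥ 2` (written with `ℓ = n + 2`). -/
noncomputable def sigma1 (θ θ₀ : ℝ) : ℝ := ∑' n : ℕ, sigma1Term (n + 2) θ θ₀

noncomputable def sigma2 (θ θ₀ : ℝ) : ℝ := ∑' n : ℕ, sigma2Term (n + 2) θ θ₀

noncomputable def sigma3 (θ θ₀ : ℝ) : ℝ := ∑' n : ℕ, sigma3Term (n + 2) θ θ₀

/-!
Write `z = cos θ`, `w = cos θ₀`, `F_ℓ(z) = (1 - z²) P_ℓ''(z)` and `λ₁ = ℓ (ℓ + 1)`. Up to a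
weight depending on `ℓ` only, the terms of the series are `F_ℓ(z) F_ℓ(w)`. The `F_ℓ` are the
bounded eigenfunctions, with eigenvalue `λ₁`, of
`F ↦ -((1 - z²) F')' + 4 F / (1 - z²)` on `[-1, 1]`, so that the first series is the expansion of
the Green function of this operator, and the second one, where `λ = λ₁ - 2`, that of the operator
shifted by `2`. The third series is half the difference of these two, term by term, because
`2 / λ₂ = 1 / λ - 1 / λ₁`.

The homogeneous solutions regular at one endpoint are `(1 - z) / (1 + z)` and
`(1 - z) (2 + z) / (1 + z)`, with their reflections, for the two operators. The Green functions
are therefore elementary (`greenKernel`). On either side of `w`, antiderivatives of their products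
with `F_ℓ` are Wronskians, in fact polynomials (`integral_greenKernel_one_mul`, `integral_greenKernel_two_mul`). Together with
the orthogonality and the norms of the `F_ℓ`, which follow from Legendre's equation by integrating
exact derivatives, this shows that for fixed `w` the series and the kernel have the same
coefficients. As the `F_ℓ` span `(1 - z²) ℝ[z]`, the theorem of Weierstrass makes them equal
(`tsum_mul_legendreF_eq`).

Convergence is uniform by the M-test (`abs_weight_mul_le`). The bounds come from Sonin's energy
`λ₁ P² + (1 - z²) P'²` and its analogue for `P'`, which increase from `z = 0` towards both
endpoints. Hence `|P_ℓ|` and `|P_ℓ'|` are at most their values at the endpoints, so that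
`F_ℓ = 2 z P_ℓ' - λ₁ P_ℓ = O(ℓ²)` (`abs_legendreF_eval_le`); and the energy of `P_ℓ` at
`w` is at most its integral over `[-1, 1]` divided by `1 - |w|`, so that `F_ℓ(w) = O(ℓ^(3/2))`
away from the endpoints (`abs_legendreF_eval_le_of_interior`).
-/

/-! ### The Legendre polynomials -/

theorem C_two_eq : (C 2 : ℝ[X]) = 2 := rfl

/-- Differentiating `(x² - 1) u' = 2 ℓ x u`, `u = (x² - 1) ^ ℓ`, repeatedly. -/
theorem iterate_derivative_sq_sub_one_pow (ℓ n : ℕ) :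
    (X ^ 2 - 1 : ℝ[X]) * derivative^[n + 2] ((X ^ 2 - 1) ^ ℓ)
      + 2 * ((n : ℝ[X]) + 1 - (ℓ : ℝ[X])) * X * derivative^[n + 1] ((X ^ 2 - 1) ^ ℓ)
      + ((n : ℝ[X]) + 1) * ((n : ℝ[X]) - 2 * (ℓ : ℝ[X])) * derivative^[n] ((X ^ 2 - 1) ^ ℓ) = 0 := by
  induction n with
  | zero =>
    have h : (X ^ 2 - 1 : ℝ[X]) * derivative ((X ^ 2 - 1) ^ ℓ)
        = 2 * (ℓ : ℝ[X]) * X * (X ^ 2 - 1) ^ ℓ := by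
      cases ℓ with
      | zero => simp
      | succ m =>
        rw [derivative_pow]
        simp only [derivative_sub, derivative_X_pow, derivative_one, Nat.add_sub_cancel, map_natCast]
        push_cast
        ring
    have h' := congrArg derivative h
    simp only [derivative_mul, derivative_sub, derivative_X_pow, derivative_one, derivative_X,
      derivative_natCast, derivative_ofNat, map_natCast] at h'
    simp only [Function.iterate_succ_apply', Function.iterate_zero_apply]
    push_cast at h' ⊢
    linear_combination h'
  | succ n ih =>
    have h' := congrArg derivative ih
    simp only [derivative_mul, derivative_add, derivative_sub, derivative_X_pow, derivative_one,
      derivative_X, derivative_natCast, derivative_ofNat, derivative_zero,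
      ← Function.iterate_succ_apply' (f := derivative)] at h'
    push_cast at h' ⊢
    rw [C_two_eq] at h'
    linear_combination h'

/-- Legendre's equation. -/
theorem legendreP_ode (ℓ : ℕ) :
    (1 - X ^ 2) * derivative (derivative (legendreP ℓ))
      = 2 * X * derivative (legendreP ℓ) - C ((ℓ : ℝ) * (ℓ + 1)) * legendreP ℓ := by
  have h := iterate_derivative_sq_sub_one_pow ℓ ℓ
  simp only [Function.iterate_succ_apply'] at h
  simp only [legendreP, derivative_C_mul, map_mul, map_add, map_natCast, map_one]
  linear_combination (-C (1 / (2 ^ ℓ * (ℓ.factorial : ℝ)))) * h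

theorem legendreP_ode_derivative (ℓ : ℕ) :
    (1 - X ^ 2) * derivative (derivative (derivative (legendreP ℓ)))
      = 4 * X * derivative (derivative (legendreP ℓ))
        - C ((ℓ : ℝ) * (ℓ + 1) - 2) * derivative (legendreP ℓ) := by
  have h := congrArg derivative (legendreP_ode ℓ)
  simp only [derivative_mul, derivative_sub, derivative_X_pow, derivative_one, derivative_X,
    derivative_ofNat, derivative_C] at h
  simp only [map_sub, C_two_eq]
  push_cast at h
  rw [C_two_eq] at h
  linear_combination h

theorem legendreP_ode_derivative_two (ℓ : ℕ) :
    (1 - X ^ 2) * derivative (derivative (derivative (derivative (legendreP ℓ))))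
      = 6 * X * derivative (derivative (derivative (legendreP ℓ)))
        - C ((ℓ : ℝ) * (ℓ + 1) - 6) * derivative (derivative (legendreP ℓ)) := by
  have h := congrArg derivative (legendreP_ode_derivative ℓ)
  simp only [derivative_mul, derivative_sub, derivative_X_pow, derivative_one, derivative_X,
    derivative_ofNat, derivative_C] at h
  have h6 : (C 6 : ℝ[X]) = 6 := rfl
  simp only [map_sub, C_two_eq, h6] at h ⊢
  push_cast at h
  rw [C_two_eq] at h
  linear_combination h

theorem legendreP_eval_one (ℓ : ℕ) : (legendreP ℓ).eval 1 = 1 := by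
  have h := aeval_iterate_derivative_self ((X ^ 2 - 1 : ℝ[X]) ^ ℓ) ℓ (1 : ℝ)
    (p' := (X + 1) ^ ℓ) (by rw [Algebra.algebraMap_self, Polynomial.map_id, ← mul_pow, C_1]; ring)
  rw [coe_aeval_eq_eval] at h
  rw [legendreP, eval_C_mul, h]
  have := Nat.factorial_ne_zero ℓ
  simp only [eval_pow, eval_add, eval_X, eval_one, nsmul_eq_mul]
  norm_num
  field_simp

theorem legendreP_eval_neg_one (ℓ : ℕ) : (legendreP ℓ).eval (-1) = (-1) ^ ℓ := by
  have h := aeval_iterate_derivative_self ((X ^ 2 - 1 : ℝ[X]) ^ ℓ) ℓ (-1 : ℝ)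
    (p' := (X - 1) ^ ℓ)
    (by rw [Algebra.algebraMap_self, Polynomial.map_id, ← mul_pow, C_neg, C_1]; ring)
  rw [coe_aeval_eq_eval] at h
  rw [legendreP, eval_C_mul, h]
  have := Nat.factorial_ne_zero ℓ
  have h2 : (-1 - 1 : ℝ) ^ ℓ = (-1) ^ ℓ * 2 ^ ℓ := by rw [← mul_pow]; norm_num
  simp only [eval_pow, eval_sub, eval_X, eval_one, nsmul_eq_mul, h2]
  field_simp

theorem degree_legendreP (ℓ : ℕ) : (legendreP ℓ).degree = ℓ := by
  have hm : ((X ^ 2 - 1 : ℝ[X]) ^ ℓ).Monic := by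
    have : (X ^ 2 - C 1 : ℝ[X]).Monic := monic_X_pow_sub_C 1 two_ne_zero
    simpa using this.pow ℓ
  have hd : ((X ^ 2 - 1 : ℝ[X]) ^ ℓ).natDegree = 2 * ℓ := by
    have : (X ^ 2 - C 1 : ℝ[X]).natDegree = 2 := natDegree_X_pow_sub_C
    rw [C_1] at this
    rw [natDegree_pow, this, mul_comm]
  have hc : (1 / (2 ^ ℓ * (ℓ.factorial : ℝ))) ≠ 0 := by positivity
  rw [legendreP, degree_C_mul hc]
  apply le_antisymm
  · refine degree_le_of_natDegree_le ((natDegree_iterate_derivative _ ℓ).trans ?_)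
    omega
  · refine le_degree_of_ne_zero ?_
    have h1 : ((X ^ 2 - 1 : ℝ[X]) ^ ℓ).coeff (ℓ + ℓ) = 1 := by
      rw [← two_mul, ← hd]; exact hm
    rw [coeff_iterate_derivative, h1, nsmul_one, Nat.cast_ne_zero, Ne, Nat.descFactorial_eq_zero_iff_lt]
    omega

theorem natDegree_legendreP (ℓ : ℕ) : (legendreP ℓ).natDegree = ℓ :=
  natDegree_eq_of_degree_eq_some (degree_legendreP ℓ)

/-- The Legendre polynomials, as a sequence with `ℓ`-th member of degree `ℓ`. -/
noncomputable def legendreSeq : Polynomial.Sequence ℝ := ⟨legendreP, degree_legendreP⟩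

/-! ### Orthogonality -/

theorem integral_eval_derivative (p : ℝ[X]) (a b : ℝ) :
    ∫ x in a..b, (derivative p).eval x = p.eval b - p.eval a :=
  intervalIntegral.integral_eq_sub_of_hasDerivAt (fun x _ => p.hasDerivAt x)
    ((derivative p).continuous.intervalIntegrable _ _)

theorem intervalIntegrable_eval (p : ℝ[X]) (a b : ℝ) :
    IntervalIntegrable (fun x => p.eval x) MeasureTheory.volume a b :=
  p.continuous.intervalIntegrable _ _

/-- Integration of polynomials over `[-1, 1]`, as a linear functional. -/
noncomputable def integralPoly : ℝ[X] →ₗ[ℝ] ℝ where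
  toFun p := ∫ x in (-1 : ℝ)..1, p.eval x
  map_add' p q := by
    simp only [eval_add]
    exact intervalIntegral.integral_add (intervalIntegrable_eval p _ _)
      (intervalIntegrable_eval q _ _)
  map_smul' c p := by simp

theorem integralPoly_apply (p : ℝ[X]) :
    integralPoly p = ∫ x in (-1 : ℝ)..1, p.eval x := rfl

theorem integralPoly_derivative (p : ℝ[X]) :
    integralPoly (derivative p) = p.eval 1 - p.eval (-1) :=
  integral_eval_derivative p _ _

theorem integralPoly_C_mul (c : ℝ) (p : ℝ[X]) : integralPoly (C c * p) = c * integralPoly p := by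
  rw [← smul_eq_C_mul, map_smul, smul_eq_mul]

theorem legendre_eigenvalue_injective {ℓ k : ℕ} (h : ℓ ≠ k) :
    (k : ℝ) * (k + 1) - ℓ * (ℓ + 1) ≠ 0 := by
  intro h0
  have h1 : ((k : ℝ) - ℓ) * (k + ℓ + 1) = 0 := by linear_combination h0
  rcases mul_eq_zero.1 h1 with h2 | h2
  · exact h (Nat.cast_injective (R := ℝ) (by linarith))
  · have : (0 : ℝ) < k + ℓ + 1 := by positivity
    exact this.ne' h2

theorem integralPoly_legendreP_mul_of_ne {ℓ k : ℕ} (h : ℓ ≠ k) :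
    integralPoly (legendreP ℓ * legendreP k) = 0 := by
  have h1 : derivative ((1 - X ^ 2) * (derivative (legendreP ℓ) * legendreP k
        - legendreP ℓ * derivative (legendreP k)))
      = C ((k : ℝ) * (k + 1) - ℓ * (ℓ + 1)) * (legendreP ℓ * legendreP k) := by
    simp only [derivative_mul, derivative_X_pow, derivative_one, map_sub,
      map_natCast]
    push_cast
    linear_combination legendreP k * legendreP_ode ℓ - legendreP ℓ * legendreP_ode k
  have h2 := integralPoly_derivative ((1 - X ^ 2) * (derivative (legendreP ℓ) * legendreP k
        - legendreP ℓ * derivative (legendreP k)))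
  rw [h1, integralPoly_C_mul] at h2
  have h3 : ((k : ℝ) * (k + 1) - ℓ * (ℓ + 1)) * integralPoly (legendreP ℓ * legendreP k) = 0 := by
    rw [h2]; simp
  exact (mul_eq_zero.1 h3).resolve_left (legendre_eigenvalue_injective h)

theorem integralPoly_legendreP_mul_of_degree_lt (ℓ : ℕ) (q : ℝ[X])
    (hq : q.degree < (ℓ : WithBot ℕ)) :
    integralPoly (legendreP ℓ * q) = 0 := by
  have hmem : q ∈ Submodule.span ℝ (legendreSeq '' Set.Iio ℓ) := by
    rw [legendreSeq.span_degreeLT fun i _ => by simp, mem_degreeLT]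
    exact hq
  clear hq
  induction hmem using Submodule.span_induction with
  | mem x hx =>
    obtain ⟨k, hk, rfl⟩ := hx
    exact integralPoly_legendreP_mul_of_ne (ne_of_gt hk)
  | zero => simp
  | add x y _ _ hx hy => rw [mul_add, map_add, hx, hy, add_zero]
  | smul c x _ hx => rw [mul_smul_comm, map_smul, hx, smul_zero]

/-- Since `x P_ℓ' - ℓ P_ℓ` has degree less than `ℓ`, integrating `(x P_ℓ²)'` gives the norm. -/
theorem integralPoly_legendreP_sq (ℓ : ℕ) :
    integralPoly (legendreP ℓ ^ 2) = 2 / (2 * ℓ + 1) := by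
  have hdeg : (X * derivative (legendreP ℓ) - C (ℓ : ℝ) * legendreP ℓ).degree
      < (ℓ : WithBot ℕ) := by
    rw [degree_lt_iff_coeff_zero]
    intro m hm
    rcases hm.eq_or_lt with rfl | hlt
    · rcases ℓ with _ | n
      · simp
      · rw [coeff_sub, coeff_X_mul, coeff_C_mul, coeff_derivative]
        push_cast; ring
    · obtain ⟨n, rfl⟩ : ∃ n, m = n + 1 := ⟨m - 1, by omega⟩
      have h0 : (legendreP ℓ).coeff (n + 1) = 0 :=
        coeff_eq_zero_of_natDegree_lt (by rwa [natDegree_legendreP])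
      rw [coeff_sub, coeff_X_mul, coeff_C_mul, coeff_derivative, h0]
      simp
  have h1 : derivative (X * legendreP ℓ ^ 2) = C (2 * (ℓ : ℝ) + 1) * legendreP ℓ ^ 2
      + C 2 * (legendreP ℓ * (X * derivative (legendreP ℓ) - C (ℓ : ℝ) * legendreP ℓ)) := by
    have h2 : (C 2 : ℝ[X]) = 2 := rfl
    simp only [derivative_mul, derivative_X, derivative_pow, map_add, map_mul, h2, map_one,
      map_natCast]
    push_cast
    ring
  have h2 := integralPoly_derivative (X * legendreP ℓ ^ 2)
  rw [h1, map_add, integralPoly_C_mul, integralPoly_C_mul,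
    integralPoly_legendreP_mul_of_degree_lt ℓ _ hdeg] at h2
  simp only [eval_mul, eval_pow, eval_X, legendreP_eval_one, legendreP_eval_neg_one] at h2
  have h3 : (((-1 : ℝ) ^ ℓ) ^ 2) = 1 := by rw [← pow_mul, mul_comm, pow_mul]; simp
  rw [h3] at h2
  field_simp
  linarith

theorem integralPoly_one_sub_sq_mul_derivative_sq (ℓ : ℕ) :
    integralPoly ((1 - X ^ 2) * derivative (legendreP ℓ) ^ 2)
      = ℓ * (ℓ + 1) * (2 / (2 * ℓ + 1)) := by
  have h1 : derivative ((1 - X ^ 2) * derivative (legendreP ℓ) * legendreP ℓ)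
      = (1 - X ^ 2) * derivative (legendreP ℓ) ^ 2
        - C ((ℓ : ℝ) * (ℓ + 1)) * legendreP ℓ ^ 2 := by
    simp only [derivative_mul, derivative_sub, derivative_X_pow, derivative_one]
    push_cast
    rw [C_two_eq]
    linear_combination legendreP ℓ * legendreP_ode ℓ
  have h2 := integralPoly_derivative ((1 - X ^ 2) * derivative (legendreP ℓ) * legendreP ℓ)
  rw [h1, map_sub, integralPoly_C_mul, integralPoly_legendreP_sq] at h2
  simp only [eval_mul, eval_sub, eval_one, eval_pow, eval_X] at h2
  linarith

theorem integralPoly_one_sub_sq_sq_mul_derivative_two_sq (ℓ : ℕ) :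
    integralPoly (((1 - X ^ 2) * derivative (derivative (legendreP ℓ))) ^ 2)
      = (ℓ * (ℓ + 1) - 2) * (ℓ * (ℓ + 1) * (2 / (2 * ℓ + 1))) := by
  have h1 : derivative ((1 - X ^ 2) ^ 2 * derivative (derivative (legendreP ℓ))
        * derivative (legendreP ℓ))
      = ((1 - X ^ 2) * derivative (derivative (legendreP ℓ))) ^ 2
        - C ((ℓ : ℝ) * (ℓ + 1) - 2) * ((1 - X ^ 2) * derivative (legendreP ℓ) ^ 2) := by
    simp only [derivative_mul, derivative_sub, derivative_one, derivative_pow, derivative_X]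
    push_cast
    simp only [C_two_eq]
    linear_combination (1 - X ^ 2) * derivative (legendreP ℓ) * legendreP_ode_derivative ℓ
  have h2 := integralPoly_derivative ((1 - X ^ 2) ^ 2 * derivative (derivative (legendreP ℓ))
        * derivative (legendreP ℓ))
  rw [h1, map_sub, integralPoly_C_mul, integralPoly_one_sub_sq_mul_derivative_sq] at h2
  simp only [eval_mul, eval_sub, eval_one, eval_pow, eval_X] at h2
  linarith

theorem integralPoly_derivative_two_mul_of_ne {ℓ k : ℕ} (h : ℓ ≠ k) :
    integralPoly (((1 - X ^ 2) * derivative (derivative (legendreP ℓ)))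
      * ((1 - X ^ 2) * derivative (derivative (legendreP k)))) = 0 := by
  set p := derivative (derivative (legendreP ℓ)) with hp
  set q := derivative (derivative (legendreP k)) with hq
  have h1 : derivative ((1 - X ^ 2) ^ 3 * (derivative p * q - p * derivative q))
      = C ((k : ℝ) * (k + 1) - ℓ * (ℓ + 1)) * (((1 - X ^ 2) * p) * ((1 - X ^ 2) * q)) := by
    have e1 := legendreP_ode_derivative_two ℓ
    have e2 := legendreP_ode_derivative_two k
    rw [← hp] at e1
    rw [← hq] at e2
    simp only [map_sub] at e1 e2 ⊢
    simp only [derivative_mul, derivative_sub, derivative_one, derivative_pow, derivative_X,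
      map_natCast]
    push_cast
    linear_combination (1 - X ^ 2) ^ 2 * q * e1 - (1 - X ^ 2) ^ 2 * p * e2
  have h2 := integralPoly_derivative ((1 - X ^ 2) ^ 3 * (derivative p * q - p * derivative q))
  rw [h1, integralPoly_C_mul] at h2
  have h3 : ((k : ℝ) * (k + 1) - ℓ * (ℓ + 1))
      * integralPoly (((1 - X ^ 2) * p) * ((1 - X ^ 2) * q)) = 0 := by
    rw [h2]; simp
  exact (mul_eq_zero.1 h3).resolve_left (legendre_eigenvalue_injective h)

/-! ### Pointwise bounds -/

/-- Sonin's energy of a solution `p` of `(1 - x²) p'' = m x p' - c p`. -/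
noncomputable def soninEnergy (c : ℝ) (p : ℝ[X]) : ℝ[X] :=
  C c * p ^ 2 + (1 - X ^ 2) * derivative p ^ 2

theorem derivative_soninEnergy {c m : ℝ} {p : ℝ[X]}
    (h : (1 - X ^ 2) * derivative (derivative p) = C m * X * derivative p - C c * p) :
    derivative (soninEnergy c p) = C (2 * m - 2) * X * derivative p ^ 2 := by
  simp only [soninEnergy, derivative_add, derivative_mul, derivative_pow,
    derivative_X, derivative_one, derivative_C, map_sub, map_mul]
  push_cast
  simp only [C_two_eq]
  linear_combination 2 * derivative p * h

theorem soninEnergy_monotoneOn {c m : ℝ} {p : ℝ[X]} (hm : 1 ≤ m)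
    (h : (1 - X ^ 2) * derivative (derivative p) = C m * X * derivative p - C c * p) :
    MonotoneOn (fun x => (soninEnergy c p).eval x) (Set.Ici 0) := by
  refine monotoneOn_of_deriv_nonneg (convex_Ici 0) (soninEnergy c p).continuous.continuousOn
    (soninEnergy c p).differentiable.differentiableOn fun x hx => ?_
  rw [interior_Ici, Set.mem_Ioi] at hx
  rw [Polynomial.deriv, derivative_soninEnergy h]
  simp only [eval_mul, eval_C, eval_X, eval_pow]
  have : 0 ≤ 2 * m - 2 := by linarith
  positivity

theorem soninEnergy_antitoneOn {c m : ℝ} {p : ℝ[X]} (hm : 1 ≤ m)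
    (h : (1 - X ^ 2) * derivative (derivative p) = C m * X * derivative p - C c * p) :
    AntitoneOn (fun x => (soninEnergy c p).eval x) (Set.Iic 0) := by
  refine antitoneOn_of_deriv_nonpos (convex_Iic 0) (soninEnergy c p).continuous.continuousOn
    (soninEnergy c p).differentiable.differentiableOn fun x hx => ?_
  rw [interior_Iic, Set.mem_Iio] at hx
  rw [Polynomial.deriv, derivative_soninEnergy h]
  simp only [eval_mul, eval_C, eval_X, eval_pow]
  exact mul_nonpos_of_nonpos_of_nonneg
    (mul_nonpos_of_nonneg_of_nonpos (by linarith) hx.le) (sq_nonneg _)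

theorem soninEnergy_eval (c : ℝ) (p : ℝ[X]) (x : ℝ) :
    (soninEnergy c p).eval x
      = c * p.eval x ^ 2 + (1 - x ^ 2) * (derivative p).eval x ^ 2 := by
  simp [soninEnergy]

theorem soninEnergy_nonneg {c : ℝ} (hc : 0 ≤ c) (p : ℝ[X]) {x : ℝ} (hx : x ∈ Set.Icc (-1 : ℝ) 1) :
    0 ≤ (soninEnergy c p).eval x := by
  rw [soninEnergy_eval]
  have : 0 ≤ 1 - x ^ 2 := by nlinarith [hx.1, hx.2]
  positivity

/-- The maxima of `|p|` on `[-1, 1]` are attained at the endpoints. -/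
theorem eval_sq_le_of_ode {c m b : ℝ} {p : ℝ[X]} (hc : 0 < c) (hm : 1 ≤ m)
    (h : (1 - X ^ 2) * derivative (derivative p) = C m * X * derivative p - C c * p)
    (h1 : p.eval 1 ^ 2 ≤ b) (h2 : p.eval (-1) ^ 2 ≤ b) {x : ℝ} (hx : x ∈ Set.Icc (-1 : ℝ) 1) :
    p.eval x ^ 2 ≤ b := by
  have hx' : 0 ≤ (1 - x ^ 2) * (derivative p).eval x ^ 2 :=
    mul_nonneg (by nlinarith [hx.1, hx.2]) (sq_nonneg _)
  refine le_of_mul_le_mul_left ?_ hc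
  rcases le_total 0 x with h0 | h0
  · have := soninEnergy_monotoneOn hm h (Set.mem_Ici.2 h0) (Set.mem_Ici.2 zero_le_one) hx.2
    simp only [soninEnergy_eval] at this
    nlinarith
  · have := soninEnergy_antitoneOn hm h (Set.mem_Iic.2 (by norm_num : (-1 : ℝ) ≤ 0))
      (Set.mem_Iic.2 h0) hx.1
    simp only [soninEnergy_eval] at this
    nlinarith

theorem legendreP_ode_C (ℓ : ℕ) :
    (1 - X ^ 2) * derivative (derivative (legendreP ℓ))
      = C 2 * X * derivative (legendreP ℓ) - C ((ℓ : ℝ) * (ℓ + 1)) * legendreP ℓ :=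
  legendreP_ode ℓ

theorem legendreP_eval_neg_one_sq (ℓ : ℕ) : (legendreP ℓ).eval (-1) ^ 2 = 1 := by
  rw [legendreP_eval_neg_one, ← pow_mul, mul_comm, pow_mul]; simp

theorem six_le_eigenvalue {ℓ : ℕ} (hℓ : 2 ≤ ℓ) : (6 : ℝ) ≤ ℓ * (ℓ + 1) := by
  have : (2 : ℝ) ≤ ℓ := by exact_mod_cast hℓ
  nlinarith

theorem legendreP_eval_sq_le {ℓ : ℕ} (hℓ : 2 ≤ ℓ) {x : ℝ} (hx : x ∈ Set.Icc (-1 : ℝ) 1) :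
    (legendreP ℓ).eval x ^ 2 ≤ 1 :=
  eval_sq_le_of_ode (by linarith [six_le_eigenvalue hℓ]) one_le_two (legendreP_ode_C ℓ)
    (by rw [legendreP_eval_one, one_pow]) (legendreP_eval_neg_one_sq ℓ).le hx

theorem derivative_legendreP_eval_sq_le {ℓ : ℕ} (hℓ : 2 ≤ ℓ) {x : ℝ}
    (hx : x ∈ Set.Icc (-1 : ℝ) 1) :
    (derivative (legendreP ℓ)).eval x ^ 2 ≤ (ℓ * (ℓ + 1) / 2) ^ 2 := by
  have hl := six_le_eigenvalue hℓ
  have e1 := congrArg (eval 1) (legendreP_ode ℓ)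
  have e2 := congrArg (eval (-1)) (legendreP_ode ℓ)
  have e3 := legendreP_eval_neg_one_sq ℓ
  simp only [eval_mul, eval_sub, eval_one, eval_pow, eval_X, eval_C, legendreP_eval_one,
    eval_ofNat] at e1 e2
  have h4 : (C 4 : ℝ[X]) = 4 := rfl
  refine eval_sq_le_of_ode (m := 4) (c := ℓ * (ℓ + 1) - 2) (by linarith) (by norm_num)
    (by rw [h4]; exact legendreP_ode_derivative ℓ) ?_ ?_ hx
  · have : (derivative (legendreP ℓ)).eval 1 = ℓ * (ℓ + 1) / 2 := by linarith
    rw [this]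
  · have : (derivative (legendreP ℓ)).eval (-1)
        = - (ℓ * (ℓ + 1) / 2 * (legendreP ℓ).eval (-1)) := by linarith
    rw [this, neg_sq, mul_pow, e3, mul_one]

/-- The numerator `F_ℓ = (1 - z²) P_ℓ''` of the spin-two harmonics, i.e. the associated Legendre
function of order two. -/
noncomputable def legendreF (ℓ : ℕ) : ℝ[X] :=
  (1 - X ^ 2) * derivative (derivative (legendreP ℓ))

theorem legendreF_eval (ℓ : ℕ) (x : ℝ) :
    (legendreF ℓ).eval x
      = 2 * x * (derivative (legendreP ℓ)).eval x - ℓ * (ℓ + 1) * (legendreP ℓ).eval x := by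
  rw [legendreF, legendreP_ode]
  simp

theorem abs_legendreF_eval_le {ℓ : ℕ} (hℓ : 2 ≤ ℓ) {x : ℝ} (hx : x ∈ Set.Icc (-1 : ℝ) 1) :
    |(legendreF ℓ).eval x| ≤ 2 * (ℓ * (ℓ + 1)) := by
  have hl := six_le_eigenvalue hℓ
  have h1 : |(legendreP ℓ).eval x| ≤ 1 := by
    rw [← sq_le_one_iff_abs_le_one]; exact legendreP_eval_sq_le hℓ hx
  have h2 : |(derivative (legendreP ℓ)).eval x| ≤ ℓ * (ℓ + 1) / 2 :=
    abs_le_of_sq_le_sq (derivative_legendreP_eval_sq_le hℓ hx) (by positivity)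
  have h3 : |x| ≤ 1 := abs_le.2 hx
  rw [legendreF_eval]
  calc |2 * x * (derivative (legendreP ℓ)).eval x - ℓ * (ℓ + 1) * (legendreP ℓ).eval x|
      ≤ |2 * x * (derivative (legendreP ℓ)).eval x| + |ℓ * (ℓ + 1) * (legendreP ℓ).eval x| :=
        abs_sub _ _
    _ = 2 * |x| * |(derivative (legendreP ℓ)).eval x|
        + ℓ * (ℓ + 1) * |(legendreP ℓ).eval x| := by
        rw [abs_mul, abs_mul, abs_mul, abs_two, abs_of_nonneg (by positivity : (0:ℝ) ≤ ℓ * (ℓ + 1))]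
    _ ≤ 2 * 1 * (ℓ * (ℓ + 1) / 2) + ℓ * (ℓ + 1) * 1 := by gcongr
    _ = 2 * (ℓ * (ℓ + 1)) := by ring

/-- The energy increases towards the nearer endpoint of `[-1, 1]`, so its value at `w`, times the
distance to that endpoint, is at most its integral, which is known from the norms. -/
theorem soninEnergy_legendreP_le (ℓ : ℕ) {w : ℝ} (hw : w ∈ Set.Icc (-1 : ℝ) 1) :
    (1 - |w|) * (soninEnergy (ℓ * (ℓ + 1)) (legendreP ℓ)).eval w
      ≤ 4 * (ℓ * (ℓ + 1)) / (2 * ℓ + 1) := by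
  set E := soninEnergy (ℓ * (ℓ + 1)) (legendreP ℓ) with hE
  have hint : ∫ x in (-1 : ℝ)..1, E.eval x = 4 * (ℓ * (ℓ + 1)) / (2 * ℓ + 1) := by
    have : integralPoly E = 4 * (ℓ * (ℓ + 1)) / (2 * ℓ + 1) := by
      rw [hE, soninEnergy, map_add, integralPoly_C_mul, integralPoly_legendreP_sq,
        integralPoly_one_sub_sq_mul_derivative_sq]
      ring
    exact this
  have hnn : ∀ x ∈ Set.Icc (-1 : ℝ) 1, 0 ≤ E.eval x := fun x hx =>
    soninEnergy_nonneg (by positivity) _ hx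
  have hsplit := intervalIntegral.integral_add_adjacent_intervals
    (intervalIntegrable_eval E (-1) w) (intervalIntegrable_eval E w 1)
  have hl : 0 ≤ ∫ x in (-1 : ℝ)..w, E.eval x :=
    intervalIntegral.integral_nonneg hw.1 fun x hx => hnn x ⟨hx.1, hx.2.trans hw.2⟩
  have hr : 0 ≤ ∫ x in w..1, E.eval x :=
    intervalIntegral.integral_nonneg hw.2 fun x hx => hnn x ⟨hw.1.trans hx.1, hx.2⟩
  rw [← hint, ← hsplit]
  rcases le_total 0 w with h0 | h0
  · have : ∫ x in w..1, E.eval w ≤ ∫ x in w..1, E.eval x :=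
      intervalIntegral.integral_mono_on hw.2 intervalIntegrable_const
        (intervalIntegrable_eval E _ _) fun x hx =>
          soninEnergy_monotoneOn one_le_two (legendreP_ode_C ℓ) (Set.mem_Ici.2 h0)
            (Set.mem_Ici.2 (h0.trans hx.1)) hx.1
    rw [intervalIntegral.integral_const, smul_eq_mul] at this
    rw [abs_of_nonneg h0]
    linarith
  · have : ∫ x in (-1 : ℝ)..w, E.eval w ≤ ∫ x in (-1 : ℝ)..w, E.eval x :=
      intervalIntegral.integral_mono_on hw.1 intervalIntegrable_const
        (intervalIntegrable_eval E _ _) fun x hx =>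
          soninEnergy_antitoneOn one_le_two (legendreP_ode_C ℓ)
            (Set.mem_Iic.2 (hx.2.trans h0)) (Set.mem_Iic.2 h0) hx.2
    rw [intervalIntegral.integral_const, smul_eq_mul] at this
    rw [abs_of_nonpos h0]
    linarith

theorem abs_legendreF_eval_le_of_interior {ℓ : ℕ} (hℓ : 2 ≤ ℓ) {w δ : ℝ} (hδ : 0 < δ)
    (hw : |w| ≤ 1 - δ) :
    |(legendreF ℓ).eval w| ≤ 7 * (ℓ * (ℓ + 1)) / (Real.sqrt (2 * ℓ + 1) * δ) := by
  have hw1 : w ∈ Set.Icc (-1 : ℝ) 1 := abs_le.1 (by linarith)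
  have hE := soninEnergy_legendreP_le ℓ hw1
  have hE0 := soninEnergy_nonneg (c := ℓ * (ℓ + 1)) (by positivity) (legendreP ℓ) hw1
  have hl := six_le_eigenvalue hℓ
  rw [soninEnergy_eval] at hE hE0
  rw [legendreF_eval]
  set P := (legendreP ℓ).eval w
  set P' := (derivative (legendreP ℓ)).eval w
  set L : ℝ := ℓ * (ℓ + 1) with hL
  have hw2 : w ^ 2 = |w| ^ 2 := (sq_abs w).symm
  have hδ1 : δ ≤ 1 := by linarith [abs_nonneg w]
  have hq : δ ≤ 1 - w ^ 2 := by rw [hw2]; nlinarith [abs_nonneg w]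
  have hm : (0 : ℝ) < 2 * ℓ + 1 := by positivity
  have h1 : δ * (L * P ^ 2 + (1 - w ^ 2) * P' ^ 2) * (2 * ℓ + 1) ≤ 4 * L := by
    rw [le_div_iff₀ hm] at hE
    refine le_trans ?_ hE
    gcongr
    linarith
  have h2 : δ * (L * P ^ 2 + δ * P' ^ 2) * (2 * ℓ + 1) ≤ 4 * L := by
    refine le_trans ?_ h1
    gcongr
  have hA : δ * P ^ 2 * (2 * ℓ + 1) ≤ 4 := by
    have : 0 ≤ δ * (δ * P' ^ 2) * (2 * ℓ + 1) := by positivity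
    have h3 : L * (δ * P ^ 2 * (2 * ℓ + 1)) ≤ L * 4 := by linarith
    exact le_of_mul_le_mul_left h3 (by linarith)
  have hB : δ ^ 2 * P' ^ 2 * (2 * ℓ + 1) ≤ 4 * L := by
    have : 0 ≤ δ * (L * P ^ 2) * (2 * ℓ + 1) := by positivity
    linarith
  -- `F² ≤ 8 P'² + 2 L² P²`, and `32 L + 8 L² ≤ 49 L²` because `L ≥ 6`.
  have hsq : (2 * w * P' - L * P) ^ 2 * (δ ^ 2 * (2 * ℓ + 1)) ≤ (7 * L) ^ 2 := by
    have hw3 : w ^ 2 ≤ 1 := by linarith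
    have c1 : (2 * w * P' - L * P) ^ 2 ≤ 8 * P' ^ 2 + 2 * L ^ 2 * P ^ 2 := by
      have : (2 * w * P' - L * P) ^ 2 ≤ 8 * (w ^ 2 * P' ^ 2) + 2 * L ^ 2 * P ^ 2 := by
        linarith [sq_nonneg (2 * w * P' + L * P)]
      have h4 : w ^ 2 * P' ^ 2 ≤ 1 * P' ^ 2 := by gcongr
      linarith
    calc (2 * w * P' - L * P) ^ 2 * (δ ^ 2 * (2 * ℓ + 1))
        ≤ (8 * P' ^ 2 + 2 * L ^ 2 * P ^ 2) * (δ ^ 2 * (2 * ℓ + 1)) := by gcongr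
      _ = 8 * (δ ^ 2 * P' ^ 2 * (2 * ℓ + 1)) + 2 * L ^ 2 * δ * (δ * P ^ 2 * (2 * ℓ + 1)) := by ring
      _ ≤ 8 * (4 * L) + 2 * L ^ 2 * 1 * 4 := by gcongr
      _ ≤ (7 * L) ^ 2 := by nlinarith
  rw [le_div_iff₀ (by positivity)]
  refine abs_le_of_sq_le_sq' ?_ (by positivity) |>.2
  rw [mul_pow, mul_pow, sq_abs, Real.sq_sqrt hm.le]
  linarith

/-! ### Expansion in the functions `F_ℓ` -/

/-- A continuous function on `[-1, 1]` all of whose moments vanish is zero. -/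
theorem eq_zero_of_integral_mul_polynomial {f : ℝ → ℝ} (hf : ContinuousOn f (Set.Icc (-1) 1))
    (h : ∀ q : ℝ[X], ∫ x in (-1 : ℝ)..1, f x * q.eval x = 0) :
    ∀ x ∈ Set.Icc (-1 : ℝ) 1, f x = 0 := by
  have hle : (-1 : ℝ) ≤ 1 := by norm_num
  have hu : Set.uIcc (-1 : ℝ) 1 = Set.Icc (-1) 1 := Set.uIcc_of_le hle
  have hff : IntervalIntegrable (fun x => f x * f x) MeasureTheory.volume (-1) 1 :=
    ContinuousOn.intervalIntegrable (by rw [hu]; exact hf.mul hf)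
  have habs : IntervalIntegrable (fun x => |f x|) MeasureTheory.volume (-1) 1 :=
    ContinuousOn.intervalIntegrable (by rw [hu]; exact hf.abs)
  have hnn : 0 ≤ ∫ x in (-1 : ℝ)..1, |f x| :=
    intervalIntegral.integral_nonneg hle fun x _ => abs_nonneg _
  -- Subtracting a polynomial close to `f` does not change `∫ f * f`.
  have hsmall : ∀ ε > 0, ∫ x in (-1 : ℝ)..1, f x * f x ≤ ε * ∫ x in (-1 : ℝ)..1, |f x| := by
    intro ε hε
    obtain ⟨q, hq⟩ := exists_polynomial_near_of_continuousOn (-1) 1 f hf ε hε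
    have hfq : IntervalIntegrable (fun x => f x * q.eval x) MeasureTheory.volume (-1) 1 :=
      ContinuousOn.intervalIntegrable (by rw [hu]; exact hf.mul q.continuous.continuousOn)
    calc ∫ x in (-1 : ℝ)..1, f x * f x
        = ∫ x in (-1 : ℝ)..1, (f x * f x - f x * q.eval x) := by
          rw [intervalIntegral.integral_sub hff hfq, h q, sub_zero]
      _ ≤ ∫ x in (-1 : ℝ)..1, ε * |f x| := by
          refine intervalIntegral.integral_mono_on hle (hff.sub hfq) (habs.const_mul ε) ?_
          intro x hx
          calc f x * f x - f x * q.eval x = f x * (f x - q.eval x) := by ring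
            _ ≤ |f x| * |f x - q.eval x| := by rw [← abs_mul]; exact le_abs_self _
            _ ≤ |f x| * ε := by
                gcongr
                rw [abs_sub_comm]
                exact (hq x hx).le
            _ = ε * |f x| := mul_comm _ _
      _ = ε * ∫ x in (-1 : ℝ)..1, |f x| := intervalIntegral.integral_const_mul _ _
  have hzero : ∫ x in (-1 : ℝ)..1, f x * f x ≤ 0 := by
    refine le_of_forall_pos_le_add fun ε hε => ?_
    have h1 : 0 < (∫ x in (-1 : ℝ)..1, |f x|) + 1 := by linarith
    have h2 := hsmall (ε / ((∫ x in (-1 : ℝ)..1, |f x|) + 1)) (by positivity)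
    refine h2.trans ?_
    rw [zero_add, div_mul_eq_mul_div, div_le_iff₀ h1]
    exact mul_le_mul_of_nonneg_left (by linarith) hε.le
  intro x hx
  by_contra hne
  have hpos := intervalIntegral.integral_pos (by norm_num : (-1 : ℝ) < 1) (hf.mul hf)
    (fun y _ => mul_self_nonneg (f y)) ⟨x, hx, mul_self_pos.2 hne⟩
  exact absurd hzero (not_le.2 hpos)

/-- The polynomials `P_{n+2}''`, as a sequence with `n`-th member of degree `n`. -/
noncomputable def legendreDerivTwoSeq : Polynomial.Sequence ℝ where
  elems' n := derivative (derivative (legendreP (n + 2)))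
  degree_eq' n := by
    have h1 := degree_derivative (p := legendreP (n + 2)) (by rw [natDegree_legendreP]; omega)
    rw [natDegree_legendreP] at h1
    have h2 : (derivative (legendreP (n + 2))).natDegree = n + 1 :=
      natDegree_eq_of_degree_eq_some h1
    rw [degree_derivative (by rw [h2]; omega), h2]
    rfl

/-- The functions `F_ℓ`, `ℓ ≥ 2`, are complete: their span is `(1 - x²) ℝ[x]`. -/
theorem eq_zero_of_integral_mul_legendreF {f : ℝ → ℝ} (hf : ContinuousOn f (Set.Icc (-1) 1))
    (h : ∀ n : ℕ, ∫ x in (-1 : ℝ)..1, f x * (legendreF (n + 2)).eval x = 0) :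
    ∀ x ∈ Set.Ioo (-1 : ℝ) 1, f x = 0 := by
  have hu : Set.uIcc (-1 : ℝ) 1 = Set.Icc (-1) 1 := Set.uIcc_of_le (by norm_num)
  have hg : ContinuousOn (fun x => f x * (1 - x ^ 2)) (Set.Icc (-1) 1) :=
    hf.mul (by fun_prop)
  have hint : ∀ q : ℝ[X], IntervalIntegrable (fun x => f x * (1 - x ^ 2) * q.eval x)
      MeasureTheory.volume (-1) 1 := fun q =>
    ContinuousOn.intervalIntegrable (by rw [hu]; exact hg.mul q.continuous.continuousOn)
  have hq : ∀ q : ℝ[X], ∫ x in (-1 : ℝ)..1, f x * (1 - x ^ 2) * q.eval x = 0 := by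
    intro q
    have hmem : q ∈ Submodule.span ℝ (Set.range legendreDerivTwoSeq) := by
      rw [legendreDerivTwoSeq.span fun i => by simp]
      trivial
    induction hmem using Submodule.span_induction with
    | mem x hx =>
      obtain ⟨n, rfl⟩ := hx
      rw [← h n]
      refine intervalIntegral.integral_congr fun x _ => ?_
      change f x * (1 - x ^ 2) * (derivative (derivative (legendreP (n + 2)))).eval x = _
      simp only [legendreF, eval_mul, eval_sub, eval_one, eval_pow, eval_X]
      ring
    | zero => simp
    | add p r _ _ hp hr =>
      simp only [eval_add, mul_add]
      rw [intervalIntegral.integral_add (hint p) (hint r), hp, hr, add_zero]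
    | smul c p _ hp =>
      simp only [eval_smul, smul_eq_mul, mul_left_comm _ c]
      rw [intervalIntegral.integral_const_mul, hp, mul_zero]
  intro x hx
  have h1 := eq_zero_of_integral_mul_polynomial hg hq x (Set.Ioo_subset_Icc_self hx)
  refine (mul_eq_zero.1 h1).resolve_right ?_
  nlinarith [hx.1, hx.2]

theorem integralPoly_legendreF_sq (ℓ : ℕ) :
    integralPoly (legendreF ℓ ^ 2)
      = (ℓ * (ℓ + 1) - 2) * (ℓ * (ℓ + 1) * (2 / (2 * ℓ + 1))) :=
  integralPoly_one_sub_sq_sq_mul_derivative_two_sq ℓ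

/-- A uniformly convergent series in the `F_ℓ` sums to `G` as soon as its coefficients are
those of `G`. -/
theorem tsum_mul_legendreF_eq {c u : ℕ → ℝ} {G : ℝ → ℝ} (hu : Summable u)
    (hcu : ∀ n, ∀ z ∈ Set.Icc (-1 : ℝ) 1, |c n * (legendreF (n + 2)).eval z| ≤ u n)
    (hG : ContinuousOn G (Set.Icc (-1) 1))
    (hcoef : ∀ k, ∫ z in (-1 : ℝ)..1, G z * (legendreF (k + 2)).eval z
      = c k * integralPoly (legendreF (k + 2) ^ 2)) :
    ∀ z ∈ Set.Ioo (-1 : ℝ) 1, ∑' n, c n * (legendreF (n + 2)).eval z = G z := by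
  have hle : (-1 : ℝ) ≤ 1 := by norm_num
  have huI : Set.uIcc (-1 : ℝ) 1 = Set.Icc (-1) 1 := Set.uIcc_of_le hle
  have hsub : Set.uIoc (-1 : ℝ) 1 ⊆ Set.Icc (-1) 1 := by
    rw [Set.uIoc_of_le hle]; exact Set.Ioc_subset_Icc_self
  set S : ℝ → ℝ := fun z => ∑' n, c n * (legendreF (n + 2)).eval z with hS
  have hScont : ContinuousOn S (Set.Icc (-1) 1) :=
    continuousOn_tsum (fun n => (continuous_const.mul (legendreF (n + 2)).continuous).continuousOn)
      hu hcu
  -- Integrating term by term, only the term `n = k` survives.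
  have hSint : ∀ k, ∫ z in (-1 : ℝ)..1, S z * (legendreF (k + 2)).eval z
      = c k * integralPoly (legendreF (k + 2) ^ 2) := by
    intro k
    have hsum : HasSum (fun n => ∫ z in (-1 : ℝ)..1,
        c n * (legendreF (n + 2)).eval z * (legendreF (k + 2)).eval z)
        (∫ z in (-1 : ℝ)..1, S z * (legendreF (k + 2)).eval z) := by
      refine intervalIntegral.hasSum_integral_of_dominated_convergence
        (fun n z => u n * |(legendreF (k + 2)).eval z|) (fun n => ?_) (fun n => ?_) ?_ ?_ ?_
      · exact (((continuous_const.mul (legendreF (n + 2)).continuous).mul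
          (legendreF (k + 2)).continuous)).aestronglyMeasurable
      · refine Eventually.of_forall fun z hz => ?_
        rw [Real.norm_eq_abs, abs_mul]
        exact mul_le_mul_of_nonneg_right (hcu n z (hsub hz)) (abs_nonneg _)
      · exact Eventually.of_forall fun z _ => hu.mul_right _
      · simp only [tsum_mul_right]
        exact (continuous_const.mul (legendreF (k + 2)).continuous.abs).intervalIntegrable _ _
      · refine Eventually.of_forall fun z hz => HasSum.mul_right _ ?_
        exact (Summable.of_norm_bounded hu fun n => hcu n z (hsub hz)).hasSum
    have hterm : ∀ n, ∫ z in (-1 : ℝ)..1,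
        c n * (legendreF (n + 2)).eval z * (legendreF (k + 2)).eval z
        = c n * integralPoly (legendreF (n + 2) * legendreF (k + 2)) := by
      intro n
      rw [integralPoly_apply, ← intervalIntegral.integral_const_mul]
      simp only [eval_mul, mul_assoc]
    rw [← hsum.tsum_eq, tsum_eq_single k, hterm, sq]
    intro n hn
    rw [hterm, legendreF, legendreF, integralPoly_derivative_two_mul_of_ne (by omega), mul_zero]
  intro z hz
  have h0 := eq_zero_of_integral_mul_legendreF (hScont.sub hG) (fun k => ?_) z hz
  · exact sub_eq_zero.1 h0
  · have i1 : IntervalIntegrable (fun z => S z * (legendreF (k + 2)).eval z)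
        MeasureTheory.volume (-1) 1 :=
      ContinuousOn.intervalIntegrable (by rw [huI]; exact hScont.mul (legendreF _).continuousOn)
    have i2 : IntervalIntegrable (fun z => G z * (legendreF (k + 2)).eval z)
        MeasureTheory.volume (-1) 1 :=
      ContinuousOn.intervalIntegrable (by rw [huI]; exact hG.mul (legendreF _).continuousOn)
    simp only [Pi.sub_apply, sub_mul]
    rw [intervalIntegral.integral_sub i1 i2, hSint, hcoef, sub_self]

/-! ### The Green kernels -/

/-- The kernel `A(max z w) B(min z w)` with `A(z) = (1 - z) p(z) / (1 + z)` and
`B(z) = (1 + z) q(z) / (1 - z)`. -/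
noncomputable def greenKernel (p q : ℝ[X]) (w z : ℝ) : ℝ :=
  ((1 - max z w) * p.eval (max z w) / (1 + max z w))
    * ((1 + min z w) * q.eval (min z w) / (1 - min z w))

theorem continuousOn_greenKernel (p q : ℝ[X]) {w : ℝ} (hw : w ∈ Set.Ioo (-1 : ℝ) 1) (s : Set ℝ) :
    ContinuousOn (greenKernel p q w) s := by
  have hp := p.continuous
  have hq := q.continuous
  refine Continuous.continuousOn ?_
  have h1 : ∀ z : ℝ, 1 + max z w ≠ 0 := fun z => by
    have := le_max_right z w
    have := hw.1
    linarith
  have h2 : ∀ z : ℝ, 1 - min z w ≠ 0 := fun z => by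
    have := min_le_right z w
    have := hw.2
    linarith
  have c1 : Continuous fun z : ℝ => max z w := continuous_id.max continuous_const
  have c2 : Continuous fun z : ℝ => min z w := continuous_id.min continuous_const
  exact (((continuous_const.sub c1).mul (hp.comp c1)).div (continuous_const.add c1) h1).mul
    (((continuous_const.add c2).mul (hq.comp c2)).div (continuous_const.sub c2) h2)

/-- On either side of `w` the kernel times `F_ℓ` is a polynomial up to a constant factor, and can
be integrated given antiderivatives `U` and `V`. -/
theorem integral_greenKernel_mul (p q U V : ℝ[X]) (ℓ : ℕ)
    (hU : derivative U = (1 + X) ^ 2 * q * derivative (derivative (legendreP ℓ)))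
    (hV : derivative V = (1 - X) ^ 2 * p * derivative (derivative (legendreP ℓ)))
    (hU0 : U.eval (-1) = 0) (hV0 : V.eval 1 = 0) {w : ℝ} (hw : w ∈ Set.Ioo (-1 : ℝ) 1) :
    ∫ z in (-1 : ℝ)..1, greenKernel p q w z * (legendreF ℓ).eval z
      = (1 - w) * p.eval w / (1 + w) * U.eval w - (1 + w) * q.eval w / (1 - w) * V.eval w := by
  have hint : ∀ a b : ℝ, IntervalIntegrable (fun z => greenKernel p q w z * (legendreF ℓ).eval z)
      MeasureTheory.volume a b := fun a b =>
    ContinuousOn.intervalIntegrable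
      ((continuousOn_greenKernel p q hw _).mul (legendreF ℓ).continuousOn)
  rw [← intervalIntegral.integral_add_adjacent_intervals (hint (-1) w) (hint w 1)]
  have h1 : ∫ z in (-1 : ℝ)..w, greenKernel p q w z * (legendreF ℓ).eval z
      = ∫ z in (-1 : ℝ)..w, (1 - w) * p.eval w / (1 + w) * (derivative U).eval z := by
    refine intervalIntegral.integral_congr fun z hz => ?_
    rw [Set.uIcc_of_le hw.1.le] at hz
    have hz1 : 1 - z ≠ 0 := by linarith [hz.2, hw.2]
    simp only [greenKernel, max_eq_right hz.2, min_eq_left hz.2, hU, legendreF, eval_mul, eval_sub,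
      eval_one, eval_pow, eval_X, eval_add]
    field_simp
    ring
  have h2 : ∫ z in w..1, greenKernel p q w z * (legendreF ℓ).eval z
      = ∫ z in w..1, (1 + w) * q.eval w / (1 - w) * (derivative V).eval z := by
    refine intervalIntegral.integral_congr fun z hz => ?_
    rw [Set.uIcc_of_le hw.2.le] at hz
    have hz1 : 1 + z ≠ 0 := by linarith [hz.1, hw.1]
    simp only [greenKernel, max_eq_left hz.1, min_eq_right hz.1, hV, legendreF, eval_mul, eval_sub,
      eval_one, eval_pow, eval_X]
    field_simp
    ring
  rw [h1, h2, intervalIntegral.integral_const_mul, intervalIntegral.integral_const_mul,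
    integral_eval_derivative, integral_eval_derivative, hU0, hV0]
  ring

/-- `(1 - z) / (1 + z)` and its inverse solve the equation of `F_ℓ` at eigenvalue `0`; the
antiderivatives are Wronskians divided by the difference `ℓ (ℓ + 1)` of the eigenvalues. -/
theorem integral_greenKernel_one_mul {ℓ : ℕ} (hℓ : 2 ≤ ℓ) {w : ℝ} (hw : w ∈ Set.Ioo (-1 : ℝ) 1) :
    ∫ z in (-1 : ℝ)..1, greenKernel 1 1 w z * (legendreF ℓ).eval z
      = 4 / (ℓ * (ℓ + 1)) * (legendreF ℓ).eval w := by
  have hl := six_le_eigenvalue hℓ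
  have ode := legendreP_ode_derivative_two ℓ
  set L : ℝ := ℓ * (ℓ + 1) with hL
  have h6 : (C 6 : ℝ[X]) = 6 := rfl
  have hC : C (-1 / L) * C L = (-1 : ℝ[X]) := by
    rw [← C_mul, div_mul_cancel₀ _ (by linarith : L ≠ 0)]; simp
  rw [map_sub, h6] at ode
  set Q := derivative (derivative (legendreP ℓ)) with hQ
  rw [integral_greenKernel_mul 1 1
    (C (-1 / L) * ((1 + X) ^ 2 * ((1 - X ^ 2) * derivative Q - 2 * X * Q - 2 * Q)))
    (C (-1 / L) * ((1 - X) ^ 2 * ((1 - X ^ 2) * derivative Q - 2 * X * Q + 2 * Q))) ℓ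
    ?_ ?_ (by simp) (by simp) hw]
  · have hw1 : 1 + w ≠ 0 := by linarith [hw.1]
    have hw2 : 1 - w ≠ 0 := by linarith [hw.2]
    have hL0 : L ≠ 0 := by linarith
    simp only [legendreF, ← hQ, eval_mul, eval_sub, eval_add, eval_one, eval_pow, eval_X, eval_C,
      eval_ofNat]
    field_simp
    ring
  · simp only [derivative_mul, derivative_sub, derivative_add, derivative_pow, derivative_X,
      derivative_one, derivative_C, derivative_ofNat]
    push_cast
    simp only [C_two_eq]
    linear_combination C (-1 / L) * (1 + X) ^ 2 * ode - (1 + X) ^ 2 * Q * hC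
  · simp only [derivative_mul, derivative_sub, derivative_add, derivative_pow, derivative_X,
      derivative_one, derivative_C, derivative_ofNat]
    push_cast
    simp only [C_two_eq]
    linear_combination C (-1 / L) * (1 - X) ^ 2 * ode - (1 - X) ^ 2 * Q * hC

/-- As for `integral_greenKernel_one_mul`, with the solutions `(1 - z) (2 + z) / (1 + z)` and
`(1 + z) (2 - z) / (1 - z)` at eigenvalue `2`. -/
theorem integral_greenKernel_two_mul {ℓ : ℕ} (hℓ : 2 ≤ ℓ) {w : ℝ} (hw : w ∈ Set.Ioo (-1 : ℝ) 1) :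
    ∫ z in (-1 : ℝ)..1, greenKernel (2 + X) (2 - X) w z * (legendreF ℓ).eval z
      = 12 / (ℓ * (ℓ + 1) - 2) * (legendreF ℓ).eval w := by
  have hl := six_le_eigenvalue hℓ
  have ode := legendreP_ode_derivative_two ℓ
  set L : ℝ := ℓ * (ℓ + 1) with hL
  have h6 : (C 6 : ℝ[X]) = 6 := rfl
  have hC : C (-1 / (L - 2)) * (C L - 2) = (-1 : ℝ[X]) := by
    rw [← C_two_eq, ← C_sub, ← C_mul, div_mul_cancel₀ _ (by linarith : L - 2 ≠ 0)]; simp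
  rw [map_sub, h6] at ode
  set Q := derivative (derivative (legendreP ℓ)) with hQ
  rw [integral_greenKernel_mul (2 + X) (2 - X)
    (C (-1 / (L - 2)) * ((1 + X) ^ 2 * ((2 - X) * ((1 - X ^ 2) * derivative Q - 2 * X * Q - 2 * Q)
      + (1 - X ^ 2) * Q)))
    (C (-1 / (L - 2)) * ((1 - X) ^ 2 * ((2 + X) * ((1 - X ^ 2) * derivative Q - 2 * X * Q + 2 * Q)
      - (1 - X ^ 2) * Q))) ℓ
    ?_ ?_ (by simp) (by simp) hw]
  · have hw1 : 1 + w ≠ 0 := by linarith [hw.1]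
    have hw2 : 1 - w ≠ 0 := by linarith [hw.2]
    have hL0 : L - 2 ≠ 0 := by linarith
    simp only [legendreF, ← hQ, eval_mul, eval_sub, eval_add, eval_one, eval_pow, eval_X, eval_C,
      eval_ofNat]
    field_simp
    ring
  · simp only [derivative_mul, derivative_sub, derivative_add, derivative_pow, derivative_X,
      derivative_one, derivative_C, derivative_ofNat]
    push_cast
    simp only [C_two_eq]
    linear_combination C (-1 / (L - 2)) * (1 + X) ^ 2 * (2 - X) * ode
      - (1 + X) ^ 2 * (2 - X) * Q * hC
  · simp only [derivative_mul, derivative_sub, derivative_add, derivative_pow, derivative_X,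
      derivative_one, derivative_C, derivative_ofNat]
    push_cast
    simp only [C_two_eq]
    linear_combination C (-1 / (L - 2)) * (1 - X) ^ 2 * (2 + X) * ode
      - (1 - X) ^ 2 * (2 + X) * Q * hC

/-! ### The three series -/

/-- The weight of `F_ℓ(z) F_ℓ(w)` in the first series. -/
noncomputable def weightOne (ℓ : ℕ) : ℝ :=
  (2 * ℓ + 1) / (4 * Real.pi * (ℓ * (ℓ + 1)) ^ 2 * (ℓ * (ℓ + 1) - 2))

/-- The weight of `F_ℓ(z) F_ℓ(w)` in the second series. -/
noncomputable def weightTwo (ℓ : ℕ) : ℝ :=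
  (2 * ℓ + 1) / (4 * Real.pi * (ℓ * (ℓ + 1)) * (ℓ * (ℓ + 1) - 2) ^ 2)

theorem lambdaS_one_add_two (n : ℕ) :
    lambdaS 1 (n + 2) = ((n + 2 : ℕ) : ℝ) * ((n + 2 : ℕ) + 1) := by
  have h : ((n + 1).factorial : ℝ) ≠ 0 := by positivity
  rw [lambdaS, div_eq_iff (by simpa using h)]
  simp only [show n + 2 - 1 = n + 1 by omega, Nat.factorial_succ (n + 2),
    Nat.factorial_succ (n + 1)]
  push_cast
  ring

theorem lambdaS_two_add_two (n : ℕ) :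
    lambdaS 2 (n + 2) = ((n + 2 : ℕ) : ℝ) * ((n + 2 : ℕ) + 1)
      * (((n + 2 : ℕ) : ℝ) * ((n + 2 : ℕ) + 1) - 2) := by
  have h : (n.factorial : ℝ) ≠ 0 := by positivity
  rw [lambdaS, div_eq_iff (by simpa using h)]
  simp only [Nat.add_sub_cancel, show n + 2 + 2 = n + 4 by omega, Nat.factorial_succ]
  push_cast
  ring

theorem six_le_eigenvalue_add_two (n : ℕ) :
    (6 : ℝ) ≤ ((n + 2 : ℕ) : ℝ) * ((n + 2 : ℕ) + 1) :=
  six_le_eigenvalue (by omega)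

theorem spinTwoY_mul_spinTwoY (n : ℕ) (θ θ₀ : ℝ) :
    spinTwoY (n + 2) θ * spinTwoY (n + 2) θ₀
      = (2 * ((n + 2 : ℕ) : ℝ) + 1) / (4 * Real.pi * lambdaS 2 (n + 2))
        * ((legendreF (n + 2)).eval (Real.cos θ) * (legendreF (n + 2)).eval (Real.cos θ₀)) := by
  have h : 0 ≤ (2 * ((n + 2 : ℕ) : ℝ) + 1) / (4 * Real.pi * lambdaS 2 (n + 2)) := by
    have : 0 ≤ lambdaS 2 (n + 2) := by rw [lambdaS]; positivity
    have := Real.pi_pos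
    positivity
  have e : ∀ t, (legendreF (n + 2)).eval (Real.cos t)
      = (1 - Real.cos t ^ 2)
        * (derivative (derivative (legendreP (n + 2)))).eval (Real.cos t) := fun t => by
    simp [legendreF]
  rw [spinTwoY, spinTwoY, ← e, ← e]
  nth_rewrite 3 [← Real.mul_self_sqrt h]
  ring

theorem sigma1Term_eq (n : ℕ) (θ θ₀ : ℝ) :
    sigma1Term (n + 2) θ θ₀ = weightOne (n + 2) * (legendreF (n + 2)).eval (Real.cos θ₀)
      * (legendreF (n + 2)).eval (Real.cos θ) := by
  have hl := six_le_eigenvalue_add_two n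
  have hp := Real.pi_pos
  rw [sigma1Term, mul_assoc, spinTwoY_mul_spinTwoY, weightOne, lambdaS_one_add_two,
    lambdaS_two_add_two]
  set L : ℝ := ((n + 2 : ℕ) : ℝ) * ((n + 2 : ℕ) + 1)
  have h1 : L ≠ 0 := by linarith
  have h2 : L - 2 ≠ 0 := by linarith
  field_simp

theorem sigma2Term_eq (n : ℕ) (θ θ₀ : ℝ) :
    sigma2Term (n + 2) θ θ₀ = weightTwo (n + 2) * (legendreF (n + 2)).eval (Real.cos θ₀)
      * (legendreF (n + 2)).eval (Real.cos θ) := by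
  have hl := six_le_eigenvalue_add_two n
  have hp := Real.pi_pos
  rw [sigma2Term, mul_assoc, spinTwoY_mul_spinTwoY, weightTwo, lambdaRatio, lambdaS_one_add_two,
    lambdaS_two_add_two]
  set L : ℝ := ((n + 2 : ℕ) : ℝ) * ((n + 2 : ℕ) + 1)
  have h1 : L ≠ 0 := by linarith
  have h2 : L - 2 ≠ 0 := by linarith
  field_simp

/-- `1 / λ₂ = (1 / λ - 1 / λ₁) / 2`, because `λ₂ = λ λ₁` and `λ = λ₁ - 2`. -/
theorem sigma3Term_eq (n : ℕ) (θ θ₀ : ℝ) :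
    sigma3Term (n + 2) θ θ₀
      = 1 / 2 * (sigma2Term (n + 2) θ θ₀ - sigma1Term (n + 2) θ θ₀) := by
  have hl := six_le_eigenvalue_add_two n
  rw [sigma1Term, sigma2Term, sigma3Term, lambdaRatio, lambdaS_one_add_two, lambdaS_two_add_two]
  set L : ℝ := ((n + 2 : ℕ) : ℝ) * ((n + 2 : ℕ) + 1)
  have h1 : L ≠ 0 := by linarith
  have h2 : L - 2 ≠ 0 := by linarith
  field_simp
  ring

/-- The majorant of the series for points `w` with `|w| ≤ 1 - δ`. -/
noncomputable def seriesMajorant (δ : ℝ) (n : ℕ) : ℝ :=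
  6 / δ * (1 / ((n + 1 : ℕ) : ℝ) ^ (3 / 2 : ℝ))

theorem summable_seriesMajorant (δ : ℝ) : Summable (seriesMajorant δ) := by
  have h : Summable fun n : ℕ => 1 / (n : ℝ) ^ (3 / 2 : ℝ) :=
    Real.summable_one_div_nat_rpow.2 (by norm_num)
  exact ((summable_nat_add_iff 1).2 h).mul_left _

theorem weightOne_nonneg (n : ℕ) : 0 ≤ weightOne (n + 2) := by
  have hl := six_le_eigenvalue_add_two n
  have : (0 : ℝ) ≤ ((n + 2 : ℕ) : ℝ) * ((n + 2 : ℕ) + 1) - 2 := by linarith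
  have := Real.pi_pos
  rw [weightOne]
  positivity

theorem weightTwo_nonneg (n : ℕ) : 0 ≤ weightTwo (n + 2) := by
  have := Real.pi_pos
  rw [weightTwo]
  positivity

/-- The ratio `λ₁ / (λ₁ - 2)` of the weights decreases in `ℓ` and is `3 / 2` at `ℓ = 2`. -/
theorem weightTwo_le (n : ℕ) : weightTwo (n + 2) ≤ 3 / 2 * weightOne (n + 2) := by
  have hl := six_le_eigenvalue_add_two n
  have h := weightOne_nonneg n
  have hp := Real.pi_pos
  have e : weightTwo (n + 2) = ((n + 2 : ℕ) : ℝ) * ((n + 2 : ℕ) + 1)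
      / (((n + 2 : ℕ) : ℝ) * ((n + 2 : ℕ) + 1) - 2) * weightOne (n + 2) := by
    rw [weightOne, weightTwo]
    set L : ℝ := ((n + 2 : ℕ) : ℝ) * ((n + 2 : ℕ) + 1)
    have h1 : L ≠ 0 := by linarith
    have h2 : L - 2 ≠ 0 := by linarith
    field_simp
  rw [e]
  refine mul_le_mul_of_nonneg_right ?_ h
  rw [div_le_iff₀ (by linarith)]
  linarith

/-- One factor is `O(ℓ²)` on all of `[-1, 1]`, the other is `O(ℓ^(3/2))` away from the endpoints,
and the weights are `O(ℓ⁻⁵)`. -/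
theorem abs_weight_mul_le (n : ℕ) {κ δ z w : ℝ} (h0 : 0 ≤ κ)
    (hκ : κ ≤ 3 / 2 * weightOne (n + 2)) (hδ : 0 < δ) (hz : z ∈ Set.Icc (-1 : ℝ) 1)
    (hw : |w| ≤ 1 - δ) :
    |κ * (legendreF (n + 2)).eval w * (legendreF (n + 2)).eval z| ≤ seriesMajorant δ n := by
  have hl := six_le_eigenvalue_add_two n
  have hp := Real.pi_gt_three
  have hF := abs_legendreF_eval_le (ℓ := n + 2) (by omega) hz
  have hFw := abs_legendreF_eval_le_of_interior (ℓ := n + 2) (by omega) hδ hw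
  have hw1 := weightOne_nonneg n
  set s := Real.sqrt (2 * ((n + 2 : ℕ) : ℝ) + 1) with hs
  have hs0 : 0 < s := Real.sqrt_pos.2 (by positivity)
  have hs2 : s * s = 2 * ((n + 2 : ℕ) : ℝ) + 1 := Real.mul_self_sqrt (by positivity)
  have hL2 : ((n + 2 : ℕ) : ℝ) * ((n + 2 : ℕ) + 1) - 2 = ((n : ℝ) + 1) * (n + 4) := by
    push_cast; ring
  rw [weightOne] at hκ hw1
  rw [← hs2] at hκ hw1
  set L : ℝ := ((n + 2 : ℕ) : ℝ) * ((n + 2 : ℕ) + 1) with hL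
  have hL0 : 0 < L := by linarith
  have hL20 : 0 < L - 2 := by linarith
  set x : ℝ := ((n + 1 : ℕ) : ℝ) with hx
  have hx0 : 0 < x := by positivity
  have hxp : x ^ (3 / 2 : ℝ) = x * Real.sqrt x := by
    rw [Real.sqrt_eq_rpow, show (3 / 2 : ℝ) = 1 + 1 / 2 by norm_num, Real.rpow_add hx0,
      Real.rpow_one]
  have hsx : s ≤ 3 * Real.sqrt x := by
    rw [hs]
    refine Real.sqrt_le_iff.2 ⟨by positivity, ?_⟩
    rw [mul_pow, Real.sq_sqrt hx0.le, hx]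
    push_cast
    linarith [(Nat.cast_nonneg n : (0 : ℝ) ≤ n)]
  have hLx : x * x ≤ L - 2 := by
    rw [hL2, hx]
    push_cast
    nlinarith [(Nat.cast_nonneg n : (0 : ℝ) ≤ n)]
  have hsqx : Real.sqrt x * Real.sqrt x = x := Real.mul_self_sqrt hx0.le
  have hsx0 : 0 < Real.sqrt x := Real.sqrt_pos.2 hx0
  rw [abs_mul, abs_mul, abs_of_nonneg h0, seriesMajorant, hxp]
  calc κ * |(legendreF (n + 2)).eval w| * |(legendreF (n + 2)).eval z|
      ≤ 3 / 2 * (s * s / (4 * Real.pi * L ^ 2 * (L - 2))) * (7 * L / (s * δ)) * (2 * L) := by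
        gcongr
    _ = 21 / (4 * Real.pi) * (1 / δ) * (s / (L - 2)) := by
        field_simp
        ring
    _ ≤ 21 / (4 * 3) * (1 / δ) * (3 * Real.sqrt x / (x * x)) := by
        gcongr
    _ = 21 / 4 * (1 / δ) * (1 / (x * Real.sqrt x)) := by
        nth_rewrite 2 [← hsqx]
        field_simp
    _ ≤ 6 * (1 / δ) * (1 / (x * Real.sqrt x)) := by
        gcongr
        norm_num
    _ = 6 / δ * (1 / (x * Real.sqrt x)) := by ring

theorem legendreF_eval_one (ℓ : ℕ) : (legendreF ℓ).eval 1 = 0 := by simp [legendreF]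

theorem legendreF_eval_neg_one (ℓ : ℕ) : (legendreF ℓ).eval (-1) = 0 := by simp [legendreF]

theorem greenKernel_comm (p q : ℝ[X]) (w z : ℝ) : greenKernel p q w z = greenKernel p q z w := by
  rw [greenKernel, greenKernel, max_comm, min_comm]

/-- The kernel vanishes when its second argument is an endpoint. At the corners, where a
denominator vanishes too, this relies on division by zero being zero. -/
theorem greenKernel_endpoint (p q : ℝ[X]) {w z : ℝ} (hw : w ∈ Set.Icc (-1 : ℝ) 1)
    (hz : z = -1 ∨ z = 1) : greenKernel p q w z = 0 := by
  rcases hz with rfl | rfl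
  · simp [greenKernel, min_eq_left hw.1]
  · simp [greenKernel, max_eq_left hw.2]

theorem eq_endpoint_or_mem_Ioo {z : ℝ} (hz : z ∈ Set.Icc (-1 : ℝ) 1) :
    (z = -1 ∨ z = 1) ∨ z ∈ Set.Ioo (-1 : ℝ) 1 := by
  rcases hz.1.eq_or_lt with h | h
  · exact Or.inl (Or.inl h.symm)
  · rcases hz.2.eq_or_lt with h' | h'
    · exact Or.inl (Or.inr h')
    · exact Or.inr ⟨h, h'⟩

/-- If the coefficients `κ_ℓ` satisfy the M-test bound and match the kernel, the series
converges absolutely and its sum is the kernel, on the whole square. -/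
theorem hasSum_greenKernel (p q : ℝ[X]) (κ : ℕ → ℝ) (a : ℝ) (h0 : ∀ n, 0 ≤ κ (n + 2))
    (hκ : ∀ n, κ (n + 2) ≤ 3 / 2 * weightOne (n + 2))
    (hcoef : ∀ n, ∀ w ∈ Set.Ioo (-1 : ℝ) 1,
      ∫ z in (-1 : ℝ)..1, a * (greenKernel p q w z * (legendreF (n + 2)).eval z)
        = κ (n + 2) * (legendreF (n + 2)).eval w * integralPoly (legendreF (n + 2) ^ 2))
    {z w : ℝ} (hz : z ∈ Set.Icc (-1 : ℝ) 1) (hw : w ∈ Set.Icc (-1 : ℝ) 1) :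
    HasSum (fun n => κ (n + 2) * (legendreF (n + 2)).eval w * (legendreF (n + 2)).eval z)
      (a * greenKernel p q w z) := by
  have hend : ∀ x : ℝ, (x = -1 ∨ x = 1) → ∀ ℓ, (legendreF ℓ).eval x = 0 := by
    rintro x (rfl | rfl) ℓ
    · exact legendreF_eval_neg_one ℓ
    · exact legendreF_eval_one ℓ
  rcases eq_endpoint_or_mem_Ioo hz with hz' | hz'
  · simp only [hend z hz', mul_zero, greenKernel_endpoint p q hw hz']
    exact hasSum_zero
  rcases eq_endpoint_or_mem_Ioo hw with hw' | hw'
  · simp only [hend w hw', mul_zero, zero_mul, greenKernel_comm p q w z,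
      greenKernel_endpoint p q hz hw']
    exact hasSum_zero
  have hδ : 0 < 1 - |w| := by linarith [abs_lt.2 hw']
  have hb : ∀ n, ∀ y ∈ Set.Icc (-1 : ℝ) 1,
      |κ (n + 2) * (legendreF (n + 2)).eval w * (legendreF (n + 2)).eval y|
        ≤ seriesMajorant (1 - |w|) n := fun n y hy =>
    abs_weight_mul_le n (h0 n) (hκ n) hδ hy (by linarith)
  have hs := summable_seriesMajorant (1 - |w|)
  have ht := tsum_mul_legendreF_eq (G := fun y => a * greenKernel p q w y) hs hb
    (continuousOn_const.mul (continuousOn_greenKernel p q hw' _))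
    (fun k => by rw [← hcoef k w hw']; simp only [mul_assoc]) z hz'
  rw [← ht]
  exact (Summable.of_norm_bounded hs fun n => hb n z hz).hasSum

theorem hasSum_sigma1Term (θ θ₀ : ℝ) :
    HasSum (fun n : ℕ => sigma1Term (n + 2) θ θ₀)
      (1 / (8 * Real.pi) * greenKernel 1 1 (Real.cos θ₀) (Real.cos θ)) := by
  simp only [sigma1Term_eq]
  refine hasSum_greenKernel 1 1 weightOne _ weightOne_nonneg
    (fun n => by linarith [weightOne_nonneg n]) (fun n w hw => ?_) (Real.cos_mem_Icc θ)
    (Real.cos_mem_Icc θ₀)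
  have hl := six_le_eigenvalue_add_two n
  have hp := Real.pi_pos
  rw [intervalIntegral.integral_const_mul, integral_greenKernel_one_mul (by omega) hw,
    integralPoly_legendreF_sq, weightOne]
  set L : ℝ := ((n + 2 : ℕ) : ℝ) * ((n + 2 : ℕ) + 1)
  have h1 : L ≠ 0 := by linarith
  have h2 : L - 2 ≠ 0 := by linarith
  field_simp
  ring

theorem hasSum_sigma2Term (θ θ₀ : ℝ) :
    HasSum (fun n : ℕ => sigma2Term (n + 2) θ θ₀)
      (1 / (24 * Real.pi) * greenKernel (2 + X) (2 - X) (Real.cos θ₀) (Real.cos θ)) := by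
  simp only [sigma2Term_eq]
  refine hasSum_greenKernel (2 + X) (2 - X) weightTwo _ weightTwo_nonneg weightTwo_le
    (fun n w hw => ?_) (Real.cos_mem_Icc θ) (Real.cos_mem_Icc θ₀)
  have hl := six_le_eigenvalue_add_two n
  have hp := Real.pi_pos
  rw [intervalIntegral.integral_const_mul, integral_greenKernel_two_mul (by omega) hw,
    integralPoly_legendreF_sq, weightTwo]
  set L : ℝ := ((n + 2 : ℕ) : ℝ) * ((n + 2 : ℕ) + 1)
  have h1 : L ≠ 0 := by linarith
  have h2 : L - 2 ≠ 0 := by linarith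
  field_simp
  ring

theorem hasSum_sigma3Term (θ θ₀ : ℝ) :
    HasSum (fun n : ℕ => sigma3Term (n + 2) θ θ₀) (1 / 2 * (sigma2 θ θ₀ - sigma1 θ θ₀)) := by
  simp only [sigma3Term_eq]
  exact ((hasSum_sigma2Term θ θ₀).summable.hasSum.sub
    (hasSum_sigma1Term θ θ₀).summable.hasSum).mul_left _

theorem greenKernel_two (w z : ℝ) :
    greenKernel (2 + X) (2 - X) w z
      = greenKernel 1 1 w z * (2 + max z w) * (2 - min z w) := by
  simp only [greenKernel, eval_add, eval_sub, eval_one, eval_X, eval_ofNat]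
  ring

/-! ### Trigonometric form -/

theorem max_cos_cos {θ θ₀ : ℝ} (h : θ ∈ Set.Icc (0 : ℝ) Real.pi)
    (h₀ : θ₀ ∈ Set.Icc (0 : ℝ) Real.pi) :
    max (Real.cos θ) (Real.cos θ₀) = Real.cos (min θ θ₀) :=
  (Real.strictAntiOn_cos.antitoneOn.map_min h h₀).symm

theorem min_cos_cos {θ θ₀ : ℝ} (h : θ ∈ Set.Icc (0 : ℝ) Real.pi)
    (h₀ : θ₀ ∈ Set.Icc (0 : ℝ) Real.pi) :
    min (Real.cos θ) (Real.cos θ₀) = Real.cos (max θ θ₀) :=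
  (Real.strictAntiOn_cos.antitoneOn.map_max h h₀).symm

theorem tan_half_sq (θ : ℝ) :
    Real.tan (θ / 2) ^ 2 = (1 - Real.cos θ) / (1 + Real.cos θ) := by
  have h : Real.cos θ = 2 * Real.cos (θ / 2) ^ 2 - 1 := by
    rw [← Real.cos_two_mul]; congr 1; ring
  have h' := Real.sin_sq_add_cos_sq (θ / 2)
  rw [Real.tan_eq_sin_div_cos, div_pow, h,
    show 1 - (2 * Real.cos (θ / 2) ^ 2 - 1) = 2 * Real.sin (θ / 2) ^ 2 by linarith,
    show 1 + (2 * Real.cos (θ / 2) ^ 2 - 1) = 2 * Real.cos (θ / 2) ^ 2 by ring,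
    mul_div_mul_left _ _ two_ne_zero]

theorem cot_half_sq (θ : ℝ) :
    Real.cot (θ / 2) ^ 2 = (1 + Real.cos θ) / (1 - Real.cos θ) := by
  rw [← Real.tan_inv_eq_cot, inv_pow, tan_half_sq, inv_div]

theorem greenKernel_one_cos {θ θ₀ : ℝ} (h : θ ∈ Set.Icc (0 : ℝ) Real.pi)
    (h₀ : θ₀ ∈ Set.Icc (0 : ℝ) Real.pi) :
    greenKernel 1 1 (Real.cos θ₀) (Real.cos θ)
      = Real.tan (min θ θ₀ / 2) ^ 2 * Real.cot (max θ θ₀ / 2) ^ 2 := by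
  rw [greenKernel, max_cos_cos h h₀, min_cos_cos h h₀, tan_half_sq, cot_half_sq]
  simp

/-! ### Uniform convergence -/

theorem tendstoUniformlyOn_sum_Icc_two {α : Type*} {f : ℕ → α → ℝ} {u : ℕ → ℝ} {s : Set α}
    (hu : Summable u) (hfu : ∀ n, ∀ x ∈ s, |f (n + 2) x| ≤ u n) :
    TendstoUniformlyOn (fun (N : ℕ) x => ∑ ℓ ∈ Finset.Icc 2 N, f ℓ x)
      (fun x => ∑' n, f (n + 2) x) atTop s := by
  have h := tendstoUniformlyOn_tsum_nat (f := fun n => f (n + 2)) hu hfu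
  intro v hv
  filter_upwards [(tendsto_sub_atTop_nat 1).eventually (h v hv)] with N hN x hx
  have e : ∑ ℓ ∈ Finset.Icc 2 N, f ℓ x = ∑ n ∈ Finset.range (N - 1), f (n + 2) x := by
    rw [← Finset.Ico_succ_right_eq_Icc, Finset.sum_Ico_eq_sum_range]
    refine Finset.sum_congr ?_ fun n _ => by rw [add_comm]
    congr 1
  simpa only [e] using hN x hx

theorem abs_cos_le_of_mem_Icc {θ₁ θ₀ : ℝ} (h1 : 0 < θ₁)
    (h : θ₀ ∈ Set.Icc θ₁ (Real.pi - θ₁)) : |Real.cos θ₀| ≤ 1 - (1 - Real.cos θ₁) := by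
  rw [sub_sub_cancel, abs_le]
  constructor
  · rw [← Real.cos_pi_sub]
    exact Real.cos_le_cos_of_nonneg_of_le_pi (by linarith [h.1]) (by linarith) h.2
  · exact Real.cos_le_cos_of_nonneg_of_le_pi h1.le (by linarith [h.2]) h.1

theorem mainTheorem8 :
    (∀ θ ∈ Set.Icc (0 : ℝ) Real.pi, ∀ θ₀ ∈ Set.Icc (0 : ℝ) Real.pi,
      0 < max θ θ₀ → min θ θ₀ < Real.pi →
      (Summable (fun n : ℕ => sigma1Term (n + 2) θ θ₀) ∧
        sigma1 θ θ₀ = 1 / (8 * Real.pi) *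
          Real.tan (min θ θ₀ / 2) ^ 2 * Real.cot (max θ θ₀ / 2) ^ 2) ∧
      (Summable (fun n : ℕ => sigma2Term (n + 2) θ θ₀) ∧
        sigma2 θ θ₀ = 1 / 3 * sigma1 θ θ₀ *
          (2 + Real.cos (min θ θ₀)) * (2 - Real.cos (max θ θ₀))) ∧
      (Summable (fun n : ℕ => sigma3Term (n + 2) θ θ₀) ∧
        sigma3 θ θ₀ = 1 / 2 * (sigma2 θ θ₀ - sigma1 θ θ₀))) ∧
    (∀ θ₁ : ℝ, 0 < θ₁ → θ₁ < Real.pi / 2 →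
      TendstoUniformlyOn
        (fun (N : ℕ) (p : ℝ × ℝ) => ∑ ℓ ∈ Finset.Icc 2 N, sigma1Term ℓ p.1 p.2)
        (fun p : ℝ × ℝ => sigma1 p.1 p.2) atTop
        (Set.Icc 0 Real.pi ×ˢ Set.Icc θ₁ (Real.pi - θ₁)) ∧
      TendstoUniformlyOn
        (fun (N : ℕ) (p : ℝ × ℝ) => ∑ ℓ ∈ Finset.Icc 2 N, sigma2Term ℓ p.1 p.2)
        (fun p : ℝ × ℝ => sigma2 p.1 p.2) atTop
        (Set.Icc 0 Real.pi ×ˢ Set.Icc θ₁ (Real.pi - θ₁)) ∧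
      TendstoUniformlyOn
        (fun (N : ℕ) (p : ℝ × ℝ) => ∑ ℓ ∈ Finset.Icc 2 N, sigma3Term ℓ p.1 p.2)
        (fun p : ℝ × ℝ => sigma3 p.1 p.2) atTop
        (Set.Icc 0 Real.pi ×ˢ Set.Icc θ₁ (Real.pi - θ₁))) := by
  constructor
  · intro θ hθ θ₀ hθ₀ _ _
    have h1 := hasSum_sigma1Term θ θ₀
    have h2 := hasSum_sigma2Term θ θ₀
    have h3 := hasSum_sigma3Term θ θ₀
    refine ⟨⟨h1.summable, ?_⟩, ⟨h2.summable, ?_⟩, ⟨h3.summable, h3.tsum_eq⟩⟩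
    · rw [sigma1, h1.tsum_eq, greenKernel_one_cos hθ hθ₀, mul_assoc]
    · rw [sigma1, sigma2, h1.tsum_eq, h2.tsum_eq, greenKernel_two, max_cos_cos hθ hθ₀,
        min_cos_cos hθ hθ₀]
      ring
  · intro θ₁ h0 hpi
    have hδ : 0 < 1 - Real.cos θ₁ := by
      have := Real.cos_lt_cos_of_nonneg_of_le_pi le_rfl (by linarith) h0
      rw [Real.cos_zero] at this
      linarith
    have hu := summable_seriesMajorant (1 - Real.cos θ₁)
    have b1 : ∀ n, ∀ p ∈ Set.Icc 0 Real.pi ×ˢ Set.Icc θ₁ (Real.pi - θ₁),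
        |sigma1Term (n + 2) p.1 p.2| ≤ seriesMajorant (1 - Real.cos θ₁) n := fun n p hp => by
      rw [sigma1Term_eq]
      exact abs_weight_mul_le n (weightOne_nonneg n) (by linarith [weightOne_nonneg n]) hδ
        (Real.cos_mem_Icc _) (abs_cos_le_of_mem_Icc h0 hp.2)
    have b2 : ∀ n, ∀ p ∈ Set.Icc 0 Real.pi ×ˢ Set.Icc θ₁ (Real.pi - θ₁),
        |sigma2Term (n + 2) p.1 p.2| ≤ seriesMajorant (1 - Real.cos θ₁) n := fun n p hp => by
      rw [sigma2Term_eq]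
      exact abs_weight_mul_le n (weightTwo_nonneg n) (weightTwo_le n) hδ
        (Real.cos_mem_Icc _) (abs_cos_le_of_mem_Icc h0 hp.2)
    refine ⟨tendstoUniformlyOn_sum_Icc_two hu b1, tendstoUniformlyOn_sum_Icc_two hu b2,
      tendstoUniformlyOn_sum_Icc_two hu fun n p hp => ?_⟩
    rw [sigma3Term_eq, abs_mul, abs_of_pos (by norm_num : (0 : ℝ) < 1 / 2)]
    linarith [abs_sub (sigma2Term (n + 2) p.1 p.2) (sigma1Term (n + 2) p.1 p.2), b1 n p hp,
      b2 n p hp]
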